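/- A hypergraph is a pair $(V,E)$, where $V$ is a finite set (of vertices) and $E$ is a set of subsets of $V$ (hyperedges); it is $n$-uniform if every hyperedge has exactly $n$ vertices. The degree of a vertex is the number of hyperedges containing it, and the maximum degree of the hypergraph is the maximum of the degrees of its vertices. In the Maker/Breaker game on a hypergraph, Maker and Breaker take turns, Maker going first, in claiming one previously unclaimed vertex, until all vertices are claimed; Maker wins if he owns all vertices of some hyperedge, otherwise Breaker wins. A strategy of Maker is a pairing strategy if there are a vertex $v_0$ and a division of all but at most one of the vertices other than $v_0$ into disjoint pairs such that Maker claims $v_0$ in his first move and, whenever Breaker claims one vertex of a pair whose other vertex is still unclaimed, Maker claims that other vertex in his next move. (In all other situations the strategy may claim any unclaimed vertex.) It is winning if Maker wins every play in which he follows it. Theorem. Let $c = \frac{64}{63}$. There is an $N$ such that for every integer $n \ge N$ for which $cn$ is a power of $2$ there is an $n$-uniform hypergraph with maximum degree exactly $\frac{2^{n-1}}{cn}$ on which Maker has a winning pairing strategy. -/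

import Mathlib

namespace Hypergraph

/-- Every hyperedge has exactly `n` vertices. -/
def IsUniform {α : Type*} (H : Hypergraph α) (n : ℕ) : Prop :=
  ∀ e ∈ H.edgeSet, e.encard = n

/-- The number of hyperedges containing `v` (meaningful when the vertex set is finite). -/
noncomputable def degree {α : Type*} (H : Hypergraph α) (v : α) : ℕ :=
  {e | e ∈ H.edgeSet ∧ v ∈ e}.ncard

/-- The maximum of the degrees of the vertices (meaningful when the vertex set is finite). -/
noncomputable def maxDegree {α : Type*} (H : Hypergraph α) : ℕ :=
  sSup (H.degree '' H.vertexSet)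

/-! A state of the Maker/Breaker game on `H` is the list of the vertices claimed so far, in the
order in which they were claimed. Maker goes first, so the entries at the even positions
`0, 2, 4, …` were claimed by Maker and those at odd positions by Breaker. -/

/-- `h` is a legal history: all claimed vertices are vertices of `H` and no vertex is claimed
twice. -/
def IsHistory {α : Type*} (H : Hypergraph α) (h : List α) : Prop :=
  h.Nodup ∧ ∀ v ∈ h, v ∈ H.vertexSet

/-- A strategy of Maker: to every legal history at which it is Maker's turn and some vertex is
still unclaimed, it assigns an unclaimed vertex. -/
structure MakerStrategy {α : Type*} (H : Hypergraph α) where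
  /-- Maker's next move as a function of the history. -/
  move : List α → α
  /-- The move claims a previously unclaimed vertex of `H`. -/
  legal : ∀ h : List α, H.IsHistory h → Even h.length → (∃ v ∈ H.vertexSet, v ∉ h) →
    move h ∈ H.vertexSet ∧ move h ∉ h

/-- A complete play of the game: a legal history in which every vertex of `H` is claimed. -/
def IsPlay {α : Type*} (H : Hypergraph α) (p : List α) : Prop :=
  H.IsHistory p ∧ ∀ v ∈ H.vertexSet, v ∈ p

/-- The vertices claimed by Maker in the history `p`. -/
def makerSet {α : Type*} (p : List α) : Set α :=
  {v | ∃ i, ∃ hi : i < p.length, Even i ∧ p[i] = v}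

namespace MakerStrategy

/-- All of Maker's moves in `p` are made according to `S`. -/
def IsFollowedIn {α : Type*} {H : Hypergraph α} (S : H.MakerStrategy) (p : List α) : Prop :=
  ∀ i, ∀ hi : i < p.length, Even i → p[i] = S.move (p.take i)

/-- `S` is winning: however Breaker plays against it, Maker in the end owns all vertices of some
hyperedge. -/
def IsWinning {α : Type*} {H : Hypergraph α} (S : H.MakerStrategy) : Prop :=
  ∀ p : List α, H.IsPlay p → S.IsFollowedIn p → ∃ e ∈ H.edgeSet, e ⊆ makerSet p

end MakerStrategy

/-- All but at most one of the vertices of `H` other than `v₀` are divided into pairs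
`{v, partner v}`. The vertices fixed by `partner` are `v₀` and the unpaired vertex, if any. -/
structure IsPairing {α : Type*} (H : Hypergraph α) (v₀ : α) (partner : α → α) : Prop where
  first_mem : v₀ ∈ H.vertexSet
  partner_mem : ∀ v ∈ H.vertexSet, partner v ∈ H.vertexSet
  partner_partner : ∀ v ∈ H.vertexSet, partner (partner v) = v
  partner_first : partner v₀ = v₀
  unpaired : {v | v ∈ H.vertexSet ∧ v ≠ v₀ ∧ partner v = v}.Subsingleton

/-- `S` is a pairing strategy: for some first vertex `v₀` and some division into pairs of all but
at most one of the remaining vertices, Maker first claims `v₀`, and whenever Breaker has just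
claimed a vertex `b` of a pair (and the other vertex of the pair is not yet claimed), Maker claims
the other vertex of that pair. -/
def MakerStrategy.IsPairingStrategy {α : Type*} {H : Hypergraph α} (S : H.MakerStrategy) : Prop :=
  ∃ v₀ : α, ∃ partner : α → α, H.IsPairing v₀ partner ∧ S.move [] = v₀ ∧
    ∀ (h : List α) (b : α), H.IsHistory (h ++ [b]) → Odd h.length →
      partner b ≠ b → partner b ∉ h → S.move (h ++ [b]) = partner b

/-- Maker has a winning pairing strategy on `H`. -/
def HasWinningPairingStrategy {α : Type*} (H : Hypergraph α) : Prop :=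
  ∃ S : H.MakerStrategy, S.IsPairingStrategy ∧ S.IsWinning

end Hypergraph

/-! Take a binary tree whose leaves all have depth at least `n - 1`, and let the hyperedges be the
sets of the lowest `n` nodes on the root-to-leaf paths. If Maker claims the root and then pairs
siblings, he owns a whole root-to-leaf path. The degree of a node is at most the number of its leaf
descendants at distance less than `n`, so it remains to bound this number by `d = 2 ^ (n - 1) / (c *
n)` at every node. Two extra stars with paired vertices make the degree exactly `d`.

The tree is described through leaf vectors: `x i` bounds the number of leaves at distance `i < n`
below a node. Splitting a node evenly halves the entries, moves them one step closer and frees `d /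
2` places at distance `n - 1`. A vector with total at most `d` and Kraft weight `∑ x i / 2 ^ i ≥ 1`
can be completed at once (`constructible_of_kraft`). Even splitting alone leads to weight about `63
/ 128`, which is too small.

The gain comes from uneven splitting (`constructible_of_nextChunks`). Of the four nodes at depth
two, one receives all the near leaves; weight `1 / 4` in the parent suffices, since distances drop
by two. The other three share the far leaves, whose weight per node is thereby multiplied by `4 /
3`. Further even splitting moves these closer and refills the far end. For `n = 63 * 2 ^ j` the
distances are grouped into 63 chunks, so that the process becomes a finite computation on lists,
independent of `j`; sixteen rounds reach weight 1 (`feasible_cuts`). -/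

/-- Finite rooted binary trees in which every inner node has two children. -/
inductive BinTree
  | leaf : BinTree
  | node : BinTree → BinTree → BinTree

/-! ### Sparse trees and the leaf vectors they realise -/

namespace BinTree

open Finset

/-- The number of leaves at distance `i` from the root. -/
def leavesAt : BinTree → ℕ → ℕ
  | leaf, 0 => 1
  | leaf, _ + 1 => 0
  | node _ _, 0 => 0
  | node l r, i + 1 => l.leavesAt i + r.leavesAt i

/-- Every node has at most `d` leaf descendants at distance less than `n`. -/
def IsSparse (n d : ℕ) : BinTree → Prop
  | leaf => ∑ i ∈ range n, leaf.leavesAt i ≤ d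
  | node l r => ∑ i ∈ range n, (node l r).leavesAt i ≤ d ∧ l.IsSparse n d ∧ r.IsSparse n d

theorem IsSparse.sum_le {n d : ℕ} {T : BinTree} (h : T.IsSparse n d) :
    ∑ i ∈ range n, T.leavesAt i ≤ d := by
  cases T with
  | leaf => exact h
  | node l r => exact h.1

/-- When all leaves have depth less than `n`, the sum counts every leaf, and a subtree cannot have
more leaves than the whole tree. -/
theorem isSparse_of_leavesAt_eq_zero {n d : ℕ} (T : BinTree) (h0 : ∀ i, n ≤ i → T.leavesAt i = 0)
    (hd : ∑ i ∈ range n, T.leavesAt i ≤ d) : T.IsSparse n d := by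
  induction T with
  | leaf => exact hd
  | node l r ihl ihr =>
    have h1 : ∑ i ∈ range n, (l.leavesAt i + r.leavesAt i) ≤ d := by
      have : ∑ i ∈ range (n + 1), (node l r).leavesAt i ≤ d := by
        rw [sum_range_succ, h0 n le_rfl]; exact hd
      rw [sum_range_succ'] at this
      exact le_trans (Nat.le_add_right _ _) this
    have h2 : ∀ i, n ≤ i → l.leavesAt i + r.leavesAt i = 0 := fun i hi => h0 (i + 1) (by omega)
    refine ⟨hd, ihl (fun i hi => ?_) ?_, ihr (fun i hi => ?_) ?_⟩
    · have := h2 i hi; omega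
    · exact (sum_le_sum fun i _ => Nat.le_add_right _ _).trans h1
    · have := h2 i hi; omega
    · exact (sum_le_sum fun i _ => Nat.le_add_left _ _).trans h1

/-- Any `j` of the leaves at depth `N` can be turned into inner nodes with two leaf children. -/
theorem exists_expand (T : BinTree) (N j : ℕ) (hj : j ≤ T.leavesAt N) :
    ∃ T' : BinTree, T'.leavesAt N + j = T.leavesAt N ∧
      T'.leavesAt (N + 1) = T.leavesAt (N + 1) + 2 * j ∧
      ∀ i, i ≠ N → i ≠ N + 1 → T'.leavesAt i = T.leavesAt i := by
  induction T generalizing N j with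
  | leaf =>
    rcases Nat.eq_zero_or_pos j with rfl | hpos
    · exact ⟨leaf, by simp⟩
    · cases N with
      | succ N => simp only [leavesAt] at hj; omega
      | zero =>
        simp only [leavesAt] at hj
        obtain rfl : j = 1 := by omega
        refine ⟨node leaf leaf, by simp [leavesAt], by simp [leavesAt], ?_⟩
        rintro (_ | _ | i) h h' <;> simp_all [leavesAt]
  | node l r ihl ihr =>
    cases N with
    | zero =>
      simp only [leavesAt] at hj
      obtain rfl : j = 0 := by omega
      exact ⟨node l r, by simp⟩
    | succ N =>
      simp only [leavesAt] at hj
      obtain ⟨l', hl1, hl2, hl3⟩ := ihl N (min j (l.leavesAt N)) (by omega)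
      obtain ⟨r', hr1, hr2, hr3⟩ := ihr N (j - min j (l.leavesAt N)) (by omega)
      refine ⟨node l' r', by simp only [leavesAt]; omega, by simp only [leavesAt]; omega, ?_⟩
      rintro (_ | i) h h'
      · rfl
      · simp only [leavesAt]
        rw [hl3 i (by omega) (by omega), hr3 i (by omega) (by omega)]

/-- Kraft's inequality, existence part. -/
theorem exists_of_kraft (N : ℕ) (x : ℕ → ℕ)
    (h : 2 ^ N ≤ ∑ i ∈ range (N + 1), x i * 2 ^ (N - i)) :
    ∃ T : BinTree, (∀ i, i ≤ N → T.leavesAt i ≤ x i) ∧ ∀ i, N < i → T.leavesAt i = 0 := by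
  induction N generalizing x with
  | zero =>
    refine ⟨leaf, fun i hi => ?_, fun i hi => ?_⟩
    · obtain rfl : i = 0 := by omega
      simpa [leavesAt] using h
    · obtain ⟨i, rfl⟩ := Nat.exists_eq_succ_of_ne_zero hi.ne'
      rfl
  | succ N ih =>
    -- Merge the leaves at depth `N + 1` in sibling pairs into leaves at depth `N`; the excess over
    -- `x N` is expanded again below.
    let x' : ℕ → ℕ := fun i => if i = N then x N + x (N + 1) / 2 else x i
    have hx' : ∀ i ∈ range N, x' i * 2 ^ (N - i) = x i * 2 ^ (N - i) := fun i hi => by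
      have := mem_range.1 hi
      simp [x', this.ne]
    have h2 : ∀ i ∈ range N, x i * 2 ^ (N + 1 - i) = 2 * (x i * 2 ^ (N - i)) := fun i hi => by
      have := mem_range.1 hi
      rw [Nat.sub_add_comm this.le, pow_succ]; ring
    obtain ⟨T, hT, hT0⟩ := ih x' (by
      rw [sum_range_succ, sum_range_succ, sum_congr rfl h2, ← mul_sum] at h
      rw [sum_range_succ, sum_congr rfl hx']
      simp only [x', if_true, Nat.sub_self, Nat.add_sub_cancel_left, pow_succ, pow_zero] at h ⊢
      omega)
    obtain ⟨T', h1, h2, h3⟩ := exists_expand T N (T.leavesAt N - x N) (by omega)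
    have hN := hT N le_rfl
    have hN1 := hT0 (N + 1) (by omega)
    simp only [x', if_true] at hN
    refine ⟨T', fun i hi => ?_, fun i hi => ?_⟩
    · rcases eq_or_ne i N with rfl | hiN
      · omega
      rcases eq_or_ne i (N + 1) with rfl | hiN1
      · omega
      rw [h3 i hiN hiN1]
      have := hT i (by omega)
      simpa [x', hiN] using this
    · rw [h3 i (by omega) (by omega)]
      exact hT0 i (by omega)

/-- Some sparse tree has at most `x i` leaves at distance `i` from its root, for all `i < n`. -/
def Constructible (n d : ℕ) (x : ℕ → ℕ) : Prop :=
  ∃ T : BinTree, T.IsSparse n d ∧ ∀ i < n, T.leavesAt i ≤ x i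

variable {n d : ℕ} {x y z : ℕ → ℕ}

theorem Constructible.mono (h : Constructible n d x) (hxy : ∀ i < n, x i ≤ y i) :
    Constructible n d y :=
  let ⟨T, hT, hx⟩ := h
  ⟨T, hT, fun i hi => (hx i hi).trans (hxy i hi)⟩

theorem constructible_of_kraft (hn : 0 < n) (hd : ∑ i ∈ range n, x i ≤ d)
    (h : 2 ^ (n - 1) ≤ ∑ i ∈ range n, x i * 2 ^ (n - 1 - i)) : Constructible n d x := by
  obtain ⟨N, rfl⟩ := Nat.exists_eq_succ_of_ne_zero hn.ne'
  obtain ⟨T, hT, hT0⟩ := exists_of_kraft N x h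
  refine ⟨T, isSparse_of_leavesAt_eq_zero T (fun i hi => hT0 i hi)
    ((sum_le_sum fun i hi => hT i ?_).trans hd), fun i hi => hT i (by omega)⟩
  have := mem_range.1 hi
  omega

/-- Only distances below `n - 1` in the children are constrained by `x`: leaves at distance `n - 1`
from a child are invisible to the parent. This is where new leaves enter. -/
theorem Constructible.node (hy : Constructible n d y) (hz : Constructible n d z)
    (hd : ∑ i ∈ range n, x i ≤ d) (h : ∀ i, i + 1 < n → y i + z i ≤ x (i + 1)) :
    Constructible n d x := by
  obtain ⟨T, hT, hTy⟩ := hy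
  obtain ⟨U, hU, hUz⟩ := hz
  have key : ∀ i < n, (BinTree.node T U).leavesAt i ≤ x i := by
    rintro (_ | i) hi
    · exact Nat.zero_le _
    · exact (Nat.add_le_add (hTy i (by omega)) (hUz i (by omega))).trans (h i hi)
  exact ⟨.node T U, ⟨(sum_le_sum fun i hi => key i (mem_range.1 hi)).trans hd, hT, hU⟩, key⟩

theorem sum_shift_le {f : ℕ → ℕ} (s : ℕ) (hf : ∀ i, i + s < n → f i ≤ x (i + s))
    (hf0 : ∀ i < n, n ≤ i + s → f i = 0) : ∑ i ∈ range n, f i ≤ ∑ i ∈ range n, x i := by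
  rcases le_total n s with h | h
  · rw [sum_eq_zero fun i hi => hf0 i (mem_range.1 hi) (by omega)]
    exact Nat.zero_le _
  · obtain ⟨m, rfl⟩ := Nat.exists_eq_add_of_le' h
    rw [sum_range_add, sum_eq_zero (s := range s) fun i hi => hf0 _ ?_ (by omega), add_zero,
      add_comm m s, sum_range_add]
    · refine le_trans (sum_le_sum fun i hi => ?_) (Nat.le_add_left _ _)
      rw [add_comm s i]
      exact hf i (by have := mem_range.1 hi; omega)
    · have := mem_range.1 hi; omega

/-- One of the four nodes at depth two is given the leaf vector `y`, the others `z`. -/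
theorem Constructible.split_four (hy : Constructible n d y) (hz : Constructible n d z)
    (hd : ∑ i ∈ range n, x i ≤ d) (h : ∀ i, i + 2 < n → y i + 3 * z i ≤ x (i + 2))
    (h0 : ∀ i < n, n ≤ i + 2 → y i = 0 ∧ z i = 0) : Constructible n d x := by
  let u : ℕ → ℕ := fun i => match i with
    | 0 => 0
    | i + 1 => y i + z i
  let v : ℕ → ℕ := fun i => match i with
    | 0 => 0
    | i + 1 => z i + z i
  have hu : ∑ i ∈ range n, u i ≤ ∑ i ∈ range n, x i := by
    refine sum_shift_le 1 ?_ ?_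
    · rintro (_ | i) hi
      · exact Nat.zero_le _
      · have : y i + 3 * z i ≤ x (i + 1 + 1) := h i (by omega)
        simp only [u]
        omega
    · rintro (_ | i) hi hi'
      · rfl
      · have := h0 i (by omega) (by omega)
        simp [u, this]
  have hv : ∑ i ∈ range n, v i ≤ ∑ i ∈ range n, x i := by
    refine sum_shift_le 1 ?_ ?_
    · rintro (_ | i) hi
      · exact Nat.zero_le _
      · have : y i + 3 * z i ≤ x (i + 1 + 1) := h i (by omega)
        simp only [v]
        omega
    · rintro (_ | i) hi hi'
      · rfl
      · have := h0 i (by omega) (by omega)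
        simp [v, this]
  refine Constructible.node (hy.node hz (hu.trans hd) fun i _ => le_rfl)
    (hz.node hz (hv.trans hd) fun i _ => le_rfl) hd ?_
  rintro (_ | i) hi
  · exact Nat.zero_le _
  · have : y i + 3 * z i ≤ x (i + 1 + 1) := h i (by omega)
    simp only [u, v]
    omega

/-- The leaf vector after `s` levels of even splitting, where after every level `d / 2` new leaves
at distance `n - 1` are added. -/
def shift (n d s : ℕ) (x : ℕ → ℕ) : ℕ → ℕ :=
  fun i => if i + s < n then x (i + s) / 2 ^ s else d / 2 ^ (n - i)

/-- Halving a total of at most `d` leaves room for exactly the `d / 2` fresh leaves, so the bound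
survives each level. It is passed on to `h`, which spares a separate estimate of the shifted vector.
-/
theorem Constructible.of_shift (s : ℕ) (hd : ∑ i ∈ range n, x i ≤ d)
    (h : ∑ i ∈ range n, shift n d s x i ≤ d → Constructible n d (shift n d s x)) :
    Constructible n d x := by
  rcases Nat.eq_zero_or_pos n with rfl | hn
  · exact (h (by simp)).mono (by simp)
  induction s generalizing x with
  | zero =>
    have h0 : ∀ i < n, shift n d 0 x i = x i := fun i hi => by simp [shift, hi]
    refine (h ?_).mono fun i hi => (h0 i hi).le
    rwa [sum_congr rfl fun i hi => h0 i (mem_range.1 hi)]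
  | succ s ih =>
    have hsum : ∑ i ∈ range n, shift n d 1 x i ≤ d := by
      obtain ⟨m, rfl⟩ := Nat.exists_eq_succ_of_ne_zero hn.ne'
      rw [sum_range_succ, sum_congr rfl (g := fun i => x (i + 1) / 2) fun i hi => ?_]
      · rw [sum_range_succ'] at hd
        have h1 : 2 * ∑ i ∈ range m, x (i + 1) / 2 ≤ ∑ i ∈ range m, x (i + 1) := by
          rw [mul_sum]
          exact sum_le_sum fun i _ => Nat.mul_div_le _ _
        simp only [shift, lt_irrefl, if_false, Nat.succ_eq_add_one, Nat.add_sub_cancel_left,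
          pow_one]
        omega
      · have := mem_range.1 hi
        simp [shift, this]
    have h1 : Constructible n d (shift n d 1 x) := by
      have hshift : ∀ i < n, shift n d s (shift n d 1 x) i = shift n d (s + 1) x i := by
        intro i hi
        simp only [shift]
        by_cases h1 : i + (s + 1) < n
        · rw [if_pos h1, if_pos (by omega), if_pos (by omega), Nat.div_div_eq_div_mul, ← pow_add,
            add_comm 1 s, add_assoc]
        · rw [if_neg h1]
          by_cases h2 : i + s < n
          · rw [if_pos h2, if_neg (by omega), Nat.div_div_eq_div_mul, ← pow_add]
            exact congrArg (fun t => d / 2 ^ t) (by omega)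
          · rw [if_neg h2]
      refine ih hsum fun hs => (h ?_).mono fun i hi => (hshift i hi).ge
      rwa [← sum_congr rfl fun i hi => hshift i (mem_range.1 hi)]
    refine h1.node h1 hd fun i hi => ?_
    simp only [shift, if_pos hi, pow_one]
    omega

end BinTree

/-! ### The construction with chunks of leaves -/

namespace BinTree

open Finset

/-! Leaf vectors of the following kind are encoded by lists: the distances `i < 63 * m` are divided
into 63 chunks of length `m`, and in the chunk number `i / m` the number of leaves at distance `i`
is `2 ^ (i - e)` times the corresponding entry of the list, except that the first two positions
of each chunk are left empty. -/

/-- The leaf vector encoded by the list `A`. -/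
def chunkVector (m e : ℕ) (A : List ℕ) : ℕ → ℕ :=
  fun i => if 2 ≤ i % m then A.getD (i / m) 0 * 2 ^ (i - e) else 0

/-- Remove the chunks `1, …, c`, scale the remaining ones by `4 / 3` and append `c` fresh ones. -/
def nextChunks (c : ℕ) (A : List ℕ) : List ℕ :=
  0 :: ((A.drop (c + 1)).map (fun a => a * 4 / 3) ++ List.replicate c 256)

/-- Successively cutting off the numbers of chunks in the first list is possible starting from the
second one, and in the end Kraft's inequality is satisfied. -/
def Feasible : List ℕ → List ℕ → Bool
  | [], A => 2 ^ 24 ≤ 511 * A.sum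
  | c :: cs, A => 1 ≤ c && c ≤ 62 && 2 ^ 22 ≤ 511 * (A.take (c + 1)).sum &&
      Feasible cs (nextChunks c A)

/-- In units of `2 ^ 15`, up to rounding, a cut of `c` chunks of weight `q ≥ 1 / 4` turns the weight
`w` into `(w - q) * 4 / 3 + c / 128`. As the entries grow, fewer chunks make up the quarter, so the
cuts get shorter. -/
theorem feasible_cuts :
    Feasible [33, 25, 23, 20, 19, 19, 17, 16, 15, 14, 14, 13, 12, 11, 11, 10]
      (0 :: List.replicate 62 256) = true := by
  decide +kernel

theorem sum_range_chunks (g : ℕ → ℕ) {m : ℕ} (hm : 2 ≤ m) (q : ℕ) :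
    ∑ t ∈ range (q * m), (if 2 ≤ t % m then g (t / m) else 0) =
      (m - 2) * ∑ J ∈ range q, g J := by
  induction q with
  | zero => simp
  | succ q ih =>
    rw [add_mul, one_mul, sum_range_add, ih, sum_range_succ, mul_add]
    congr 1
    have h1 : ∀ t ∈ range m, (if 2 ≤ (q * m + t) % m then g ((q * m + t) / m) else 0) =
        if 2 ≤ t then g q else 0 := fun t ht => by
      have ht := mem_range.1 ht
      rw [Nat.mul_add_mod', Nat.mod_eq_of_lt ht, mul_comm q m, Nat.mul_add_div (by omega),
        Nat.div_eq_of_lt ht, add_zero]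
    obtain ⟨l, rfl⟩ := Nat.exists_eq_add_of_le hm
    rw [sum_congr rfl h1, sum_range_add]
    simp [sum_range_succ]

theorem sum_range_getD (A : List ℕ) {q : ℕ} (h : A.length ≤ q) :
    ∑ J ∈ range q, A.getD J 0 = A.sum := by
  induction A generalizing q with
  | nil => simp
  | cons a A ih =>
    obtain ⟨q, rfl⟩ := Nat.exists_eq_succ_of_ne_zero (n := q) (by rintro rfl; simp at h)
    rw [sum_range_succ', List.sum_cons, ← ih (q := q) (by simpa using h)]
    simp [add_comm]

theorem length_nextChunks {c : ℕ} {A : List ℕ} (hA : A.length = 63) (hc : c ≤ 62) :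
    (nextChunks c A).length = 63 := by
  simp [nextChunks, hA]
  omega

theorem getD_nextChunks_of_lt {c J : ℕ} {A : List ℕ} (hA : A.length = 63) (hJ : 0 < J)
    (h : J + c < 63) : (nextChunks c A).getD J 0 = A.getD (J + c) 0 * 4 / 3 := by
  obtain ⟨J, rfl⟩ := Nat.exists_eq_succ_of_ne_zero hJ.ne'
  have h1 : J + 1 + c < A.length := by omega
  have h2 : J < ((A.drop (c + 1)).map (fun a => a * 4 / 3)).length := by simp; omega
  simp only [nextChunks, List.getD_cons_succ, Nat.succ_eq_add_one]
  rw [List.getD_append _ _ _ _ h2, List.getD_eq_getElem _ _ h2, List.getD_eq_getElem _ _ h1]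
  simp [show c + 1 + J = J + 1 + c by omega]

theorem getD_nextChunks_le {c J : ℕ} {A : List ℕ} (hA : A.length = 63) (hc : c ≤ 62)
    (h : 63 ≤ J + c) : (nextChunks c A).getD J 0 ≤ 256 := by
  obtain ⟨J, rfl⟩ := Nat.exists_eq_succ_of_ne_zero (n := J) (by omega)
  have h2 : ((A.drop (c + 1)).map (fun a => a * 4 / 3)).length ≤ J := by simp; omega
  simp only [nextChunks, List.getD_cons_succ, Nat.succ_eq_add_one]
  rw [List.getD_append_right _ _ _ _ h2]
  generalize J - _ = t
  rcases lt_or_ge t c with ht | ht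
  · rw [List.getD_eq_getElem _ _ (by simpa using ht)]
    simp
  · rw [List.getD_eq_default _ _ (by simpa using ht)]
    simp

theorem add_fifteen_le_two_pow {j : ℕ} (hj : 10 ≤ j) : j + 15 ≤ 2 ^ j := by
  obtain ⟨a, rfl⟩ := Nat.exists_eq_add_of_le hj
  have : a < 2 ^ a := Nat.lt_two_pow_self
  rw [pow_add]
  omega

/-- If the chunks add up to enough, the leaf vector satisfies Kraft's inequality, even
if all distances are reduced by `s ≤ 2`. -/
theorem kraft_chunkVector {j s n : ℕ} {A : List ℕ} (hj : 10 ≤ j) (hn : n = 63 * 2 ^ j)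
    (hA : A.length ≤ 63) (hA0 : A.getD 0 0 = 0) (hs : s ≤ 2)
    (h : 2 ^ (24 - s) ≤ 511 * A.sum) :
    2 ^ (n - 1) ≤ ∑ i ∈ range (n - s),
      chunkVector (2 ^ j) (j + 15) A (i + s) * 2 ^ (n - 1 - i) := by
  have hm : 2 ^ 10 ≤ 2 ^ j := Nat.pow_le_pow_right (by norm_num) hj
  have hjm := add_fifteen_le_two_pow hj
  set m := 2 ^ j with hmdef
  let f : ℕ → ℕ := fun t =>
    if 2 ≤ t % m then A.getD (t / m) 0 * 2 ^ (n - 1 + s - (j + 15)) else 0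
  -- The empty chunk 0 ensures `t ≥ m ≥ j + 15`, so the truncated subtraction in `chunkVector` is a
  -- true one.
  have hf : ∀ t < n, chunkVector m (j + 15) A t * 2 ^ (n - 1 + s - t) = f t := fun t ht => by
    simp only [chunkVector, f]
    split_ifs with h2
    · rcases Nat.eq_zero_or_pos (t / m) with h0 | h0
      · rw [h0, hA0]; simp
      · have : m ≤ t := (Nat.div_pos_iff.1 h0).2
        rw [mul_assoc, ← pow_add]
        congr 2
        omega
    · simp
  have hsum : ∑ i ∈ range (n - s), chunkVector m (j + 15) A (i + s) * 2 ^ (n - 1 - i) =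
      ∑ t ∈ range n, f t := by
    have hns : n = s + (n - s) := by omega
    conv_rhs => rw [hns, sum_range_add]
    rw [sum_eq_zero (s := range s) fun t ht => ?_, zero_add]
    · refine sum_congr rfl fun i hi => ?_
      have := mem_range.1 hi
      rw [add_comm s i, ← hf _ (by omega)]
      congr 2
      omega
    · have := mem_range.1 ht
      simp only [f]
      rw [if_neg]
      rw [Nat.mod_eq_of_lt (by omega)]
      omega
  have hchunks : ∑ t ∈ range (63 * m), f t = (m - 2) * ∑ J ∈ range 63, _ :=
    sum_range_chunks (fun J => A.getD J 0 * 2 ^ (n - 1 + s - (j + 15))) (by omega) 63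
  rw [hsum, hn, hchunks, ← hn, ← sum_mul, sum_range_getD A hA]
  -- The factor `511 / 512` pays for the two empty positions per chunk; it is enough because `m ≥
  -- 1024`.
  have h3 : 2 ^ (15 - s) * m ≤ (m - 2) * A.sum := by
    have h1 : 511 * m ≤ 512 * (m - 2) := by omega
    have h2 : 2 ^ (24 - s) = 512 * 2 ^ (15 - s) := by
      rw [show 24 - s = 9 + (15 - s) by omega, pow_add]; norm_num
    have h4 : 512 * (511 * (2 ^ (15 - s) * m)) ≤ 512 * (511 * ((m - 2) * A.sum)) := by
      calc 512 * (511 * (2 ^ (15 - s) * m)) = (511 * m) * (512 * 2 ^ (15 - s)) := by ring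
        _ ≤ (512 * (m - 2)) * (511 * A.sum) := Nat.mul_le_mul h1 (h2 ▸ h)
        _ = _ := by ring
    omega
  calc 2 ^ (n - 1) = 2 ^ (15 - s) * m * 2 ^ (n - 1 + s - (j + 15)) := by
        rw [show 2 ^ (15 - s) * m = 2 ^ (15 - s + j) by rw [pow_add], ← pow_add]
        congr 1
        omega
    _ ≤ (m - 2) * A.sum * 2 ^ (n - 1 + s - (j + 15)) := Nat.mul_le_mul_right _ h3
    _ = _ := by ring

variable {j n d : ℕ} {A : List ℕ}

/-- Fresh entries equal `2 ^ (i - (j + 7))`, that is, 256 in the unit of `chunkVector`; the eight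
extra bits keep the rounding of `4 / 3` harmless. -/
theorem fresh_le {i a : ℕ} (hd : d = 2 ^ (n - 1 - (j + 6))) (hi : i < n) (hji : j + 15 ≤ i)
    (ha : a ≤ 256) : a * 2 ^ (i - (j + 15)) ≤ d / 2 ^ (n - i) := by
  rw [hd, Nat.pow_div (by omega) (by norm_num)]
  calc a * 2 ^ (i - (j + 15)) ≤ 2 ^ 8 * 2 ^ (i - (j + 15)) := Nat.mul_le_mul_right _ (by omega)
    _ = _ := by rw [← pow_add]; congr 1; omega

theorem constructible_of_nextChunks {c : ℕ} (hj : 10 ≤ j) (hn : n = 63 * 2 ^ j)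
    (hd : d = 2 ^ (n - 1 - (j + 6))) (hA : A.length = 63) (hA0 : A.getD 0 0 = 0)
    (hc1 : 1 ≤ c) (hc : c ≤ 62) (hlow : 2 ^ 22 ≤ 511 * (A.take (c + 1)).sum)
    (ih : ∑ i ∈ range n, chunkVector (2 ^ j) (j + 15) (nextChunks c A) i ≤ d →
      Constructible n d (chunkVector (2 ^ j) (j + 15) (nextChunks c A)))
    (hsum : ∑ i ∈ range n, chunkVector (2 ^ j) (j + 15) A i ≤ d) :
    Constructible n d (chunkVector (2 ^ j) (j + 15) A) := by
  have hjm := add_fifteen_le_two_pow hj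
  have h2j : 2 ^ (n - 1) ≤ ∑ i ∈ range (n - 2),
      chunkVector (2 ^ j) (j + 15) (A.take (c + 1)) (i + 2) * 2 ^ (n - 1 - i) := by
    refine kraft_chunkVector hj hn (by simp; omega) ?_ le_rfl hlow
    simpa [List.getD_eq_getElem?_getD] using hA0
  obtain ⟨m, hm⟩ : ∃ m, m = 2 ^ j := ⟨_, rfl⟩
  rw [← hm] at hn hsum hjm h2j ih ⊢
  -- `y` takes the chunks up to `c`, and `z` a third of each later one.
  let y : ℕ → ℕ := fun i => if i + 2 < n then chunkVector m (j + 15) (A.take (c + 1)) (i + 2) else 0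
  let z : ℕ → ℕ := fun i =>
    if i + 2 < n ∧ c < (i + 2) / m then chunkVector m (j + 15) A (i + 2) / 3 else 0
  have htake : ∀ J, J ≤ c → (A.take (c + 1)).getD J 0 = A.getD J 0 := fun J hJ => by
    simp [List.getD_eq_getElem?_getD, show J < c + 1 by omega]
  have htake0 : ∀ J, c < J → (A.take (c + 1)).getD J 0 = 0 := fun J hJ => by
    simp [List.getD_eq_getElem?_getD, show ¬ J < c + 1 by omega]
  have hyz : ∀ i, i + 2 < n → y i + 3 * z i ≤ chunkVector m (j + 15) A (i + 2) := fun i hi => by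
    simp only [y, z, hi, true_and, if_true]
    split_ifs with h
    · have : chunkVector m (j + 15) (A.take (c + 1)) (i + 2) = 0 := by
        simp only [chunkVector, htake0 _ h, zero_mul, ite_self]
      omega
    · simp only [chunkVector, htake _ (not_lt.1 h), mul_zero, add_zero, le_refl]
  have h0 : ∀ i < n, n ≤ i + 2 → y i = 0 ∧ z i = 0 := fun i _ hi => by
    simp [y, z, show ¬ i + 2 < n by omega]
  have hysum : ∑ i ∈ range n, y i ≤ d :=
    (sum_shift_le 2 (fun i hi => by have := hyz i hi; omega) fun i hi hi' => (h0 i hi hi').1).trans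
      hsum
  have hzsum : ∑ i ∈ range n, z i ≤ d :=
    (sum_shift_le 2 (fun i hi => by have := hyz i hi; omega) fun i hi hi' => (h0 i hi hi').2).trans
      hsum
  have hcm : m ≤ c * m := Nat.le_mul_of_pos_left m hc1
  -- Two levels of uneven and `c * m - 2` levels of even splitting move everything by exactly `c`
  -- chunks.
  have hle : ∀ i < n, chunkVector m (j + 15) (nextChunks c A) i ≤ shift n d (c * m - 2) z i := by
    intro i hi
    by_cases h2 : 2 ≤ i % m
    swap
    · simp [chunkVector, h2]
    rcases Nat.eq_zero_or_pos (i / m) with hJ | hJ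
    · simp [chunkVector, hJ, nextChunks]
    have hmi : m ≤ i := (Nat.div_pos_iff.1 hJ).2
    have hdiv : (i + c * m) / m = i / m + c := Nat.add_mul_div_right _ _ (by omega)
    have hmod : (i + c * m) % m = i % m := Nat.add_mul_mod_self_right _ _ _
    have hdm : m * ((i + c * m) / m) + (i + c * m) % m = i + c * m := Nat.div_add_mod _ _
    simp only [chunkVector, if_pos h2, shift]
    rcases lt_or_ge (i / m + c) 63 with h63 | h63
    · have hin : i + c * m < n := by
        rw [hn]
        exact (Nat.div_lt_iff_lt_mul (by omega)).1 (by rw [hdiv]; exact h63)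
      rw [getD_nextChunks_of_lt hA hJ h63, if_pos (by omega)]
      simp only [z, chunkVector]
      rw [show i + (c * m - 2) + 2 = i + c * m by omega, hdiv, hmod, if_pos ⟨hin, by omega⟩,
        if_pos h2, Nat.le_div_iff_mul_le (by positivity), Nat.le_div_iff_mul_le (by norm_num)]
      calc A.getD (i / m + c) 0 * 4 / 3 * 2 ^ (i - (j + 15)) * 2 ^ (c * m - 2) * 3
          = 3 * (A.getD (i / m + c) 0 * 4 / 3) * (2 ^ (i - (j + 15)) * 2 ^ (c * m - 2)) := by ring
        _ ≤ A.getD (i / m + c) 0 * 4 * (2 ^ (i - (j + 15)) * 2 ^ (c * m - 2)) :=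
          Nat.mul_le_mul_right _ (Nat.mul_div_le _ _)
        _ = A.getD (i / m + c) 0 * (2 ^ 2 * 2 ^ (i - (j + 15)) * 2 ^ (c * m - 2)) := by ring
        _ = _ := by
          rw [← pow_add, ← pow_add]
          congr 2
          omega
    -- The first two levels add no fresh leaves, which leaves a gap at the first two positions of
    -- chunk `63 - c`; hence those positions are kept empty in every chunk.
    · have hin : n + 2 ≤ i + c * m := by
        have : m * 63 ≤ m * ((i + c * m) / m) := Nat.mul_le_mul_left _ (by omega)
        omega
      rw [if_neg (by omega)]
      exact fresh_le hd hi (by omega) (getD_nextChunks_le hA hc h63)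
  have hz : Constructible n d z := by
    refine Constructible.of_shift (c * m - 2) hzsum fun hs => ?_
    exact (ih ((sum_le_sum fun i hi => hle i (mem_range.1 hi)).trans hs)).mono hle
  refine Constructible.split_four (constructible_of_kraft (by omega) hysum ?_) hz hsum hyz h0
  refine h2j.trans ?_
  calc _ = ∑ i ∈ range (n - 2), y i * 2 ^ (n - 1 - i) := sum_congr rfl fun i hi => by
        have := mem_range.1 hi
        simp only [y]
        rw [if_pos (by omega)]
    _ ≤ _ := sum_le_sum_of_subset (range_mono (Nat.sub_le _ _))

theorem constructible_of_feasible (hj : 10 ≤ j) (hn : n = 63 * 2 ^ j)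
    (hd : d = 2 ^ (n - 1 - (j + 6))) (cs : List ℕ) (hA : A.length = 63) (hA0 : A.getD 0 0 = 0)
    (h : Feasible cs A = true)
    (hsum : ∑ i ∈ range n, chunkVector (2 ^ j) (j + 15) A i ≤ d) :
    Constructible n d (chunkVector (2 ^ j) (j + 15) A) := by
  induction cs generalizing A with
  | nil =>
    have hpos : 0 < 2 ^ j := Nat.two_pow_pos j
    exact constructible_of_kraft (by omega) hsum
      (kraft_chunkVector (s := 0) hj hn hA.le hA0 (by omega) (by simpa [Feasible] using h))
  | cons c cs ih =>
    simp only [Feasible, Bool.and_eq_true, decide_eq_true_eq] at h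
    obtain ⟨⟨⟨hc1, hc⟩, hlow⟩, hnext⟩ := h
    exact constructible_of_nextChunks hj hn hd hA hA0 hc1 hc hlow
      (ih (length_nextChunks hA hc) (by simp [nextChunks]) hnext) hsum

/-- There is a binary tree without leaves at depth less than `n - 1` in which every node has at
most `2 ^ (n - 1) / (64 * n / 63)` leaf descendants at distance less than `n`. -/
theorem exists_isSparse (hj : 10 ≤ j) (hn : n = 63 * 2 ^ j) (hd : d = 2 ^ (n - 1 - (j + 6))) :
    ∃ T : BinTree, T.IsSparse n d ∧ ∀ i < n - 1, T.leavesAt i = 0 := by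
  have hjm := add_fifteen_le_two_pow hj
  obtain ⟨T, hT, hTx⟩ : Constructible n d (fun i => if i = n - 1 then d else 0) := by
    -- Start from `d` leaves at distance `n - 1` only and split evenly `n - 1` times: all positive
    -- distances then hold fresh entries.
    refine Constructible.of_shift (n - 1) ?_ fun hs => ?_
    · rw [sum_ite_eq']
      split_ifs <;> simp
    · have hle : ∀ i < n, chunkVector (2 ^ j) (j + 15) (0 :: List.replicate 62 256) i ≤
          shift n d (n - 1) (fun i => if i = n - 1 then d else 0) i := by
        intro i hi
        by_cases h2 : 2 ≤ i % 2 ^ j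
        swap
        · simp [chunkVector, h2]
        rcases Nat.eq_zero_or_pos (i / 2 ^ j) with hJ | hJ
        · simp [chunkVector, hJ]
        have hmi : 2 ^ j ≤ i := (Nat.div_pos_iff.1 hJ).2
        simp only [chunkVector, if_pos h2, shift]
        rw [if_neg (by omega)]
        refine fresh_le hd hi (by omega) ?_
        obtain ⟨t, ht⟩ := Nat.exists_eq_succ_of_ne_zero hJ.ne'
        rw [ht, List.getD_cons_succ]
        rcases lt_or_ge t 62 with h | h
        · rw [List.getD_eq_getElem _ _ (by simpa using h), List.getElem_replicate]
        · rw [List.getD_eq_default _ _ (by simpa using h)]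
          exact Nat.zero_le _
      exact (constructible_of_feasible hj hn hd _ (by simp) (by simp) feasible_cuts
        ((sum_le_sum fun i hi => hle i (mem_range.1 hi)).trans hs)).mono hle
  refine ⟨T, hT, fun i hi => ?_⟩
  simpa [hi.ne] using hTx i (by omega)

end BinTree

/-! ### Pairing strategies -/

namespace Hypergraph

variable {α : Type*}

/-- The pairing strategy: answer Breaker's last move in its pair if possible, and otherwise claim
any unclaimed vertex. -/
noncomputable def pairingMove (H : Hypergraph α) (v₀ : α) (partner : α → α) (h : List α) : α :=
  open Classical in
  match h.getLast? with
  | none => v₀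
  | some b =>
    if partner b ∉ h ∧ b ∈ H.vertexSet then partner b
    else if hv : ∃ v ∈ H.vertexSet, v ∉ h then hv.choose else v₀

theorem pairingMove_append (H : Hypergraph α) (v₀ : α) (partner : α → α) {h : List α} {b : α}
    (hb : b ∈ H.vertexSet) (hp : partner b ≠ b) (hph : partner b ∉ h) :
    H.pairingMove v₀ partner (h ++ [b]) = partner b := by
  simp [pairingMove, hb, hp, hph]

/-- Maker wins by pairing if every set that contains `v₀` and meets every pair contains a
hyperedge. -/
theorem hasWinningPairingStrategy_of_isPairing {H : Hypergraph α} {v₀ : α} {partner : α → α}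
    (hP : H.IsPairing v₀ partner)
    (hwin : ∀ M : Set α, v₀ ∈ M → (∀ v ∈ H.vertexSet, partner v ≠ v → v ∈ M ∨ partner v ∈ M) →
      ∃ e ∈ H.edgeSet, e ⊆ M) : H.HasWinningPairingStrategy := by
  refine ⟨⟨H.pairingMove v₀ partner, ?_⟩, ⟨v₀, partner, hP, rfl, ?_⟩, ?_⟩
  · intro h hh _ hex
    rcases h.eq_nil_or_concat with rfl | ⟨l, b, rfl⟩
    · exact ⟨hP.first_mem, by simp⟩
    · rw [List.concat_eq_append] at hex ⊢
      simp only [pairingMove, List.getLast?_append, List.getLast?_singleton,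
        Option.some_or]
      split_ifs with h1
      · exact ⟨hP.partner_mem b h1.2, h1.1⟩
      · exact hex.choose_spec
  · intro h b hh _ hp hph
    exact pairingMove_append H v₀ partner (hh.2 b (by simp)) hp hph
  · intro p hp hS
    refine hwin _ ?_ fun v hv hpv => ?_
    · have hlen : 0 < p.length := List.length_pos_of_mem (hp.2 v₀ hP.first_mem)
      exact ⟨0, hlen, Even.zero, hS 0 hlen Even.zero⟩
    -- If Breaker claims `v` before its partner is claimed, Maker's very next move takes the
    -- partner.
    · have key : ∀ v ∈ H.vertexSet, partner v ≠ v → ∀ i j, ∀ hi : i < p.length,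
          ∀ hj : j < p.length, p[i] = v → p[j] = partner v → i < j → ¬ Even i →
          partner v ∈ makerSet p := by
        intro v hv hpv i j hi hj hiv hjv hij hodd
        have hi1 : i + 1 < p.length := by omega
        have heven : Even (i + 1) := Nat.even_add_one.2 hodd
        refine ⟨i + 1, hi1, heven, ?_⟩
        rw [hS (i + 1) hi1 heven, List.take_add_one, List.getElem?_eq_getElem hi, hiv]
        refine pairingMove_append H v₀ partner hv hpv fun hmem => ?_
        obtain ⟨t, ht, hteq⟩ := List.mem_iff_getElem.1 hmem
        rw [List.getElem_take, ← hjv] at hteq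
        have := (List.Nodup.getElem_inj_iff hp.1.1).1 hteq
        simp only [List.length_take] at ht
        omega
      obtain ⟨i, hi, hiv⟩ := List.mem_iff_getElem.1 (hp.2 v hv)
      obtain ⟨j, hj, hjv⟩ := List.mem_iff_getElem.1 (hp.2 _ (hP.partner_mem v hv))
      by_cases hei : Even i
      · exact Or.inl ⟨i, hi, hei, hiv⟩
      by_cases hej : Even j
      · exact Or.inr ⟨j, hj, hej, hjv⟩
      rcases lt_trichotomy i j with hij | rfl | hij
      · exact Or.inr (key v hv hpv i j hi hj hiv hjv hij hei)
      · exact absurd (hjv.symm.trans hiv) hpv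
      · have := key (partner v) (hP.partner_mem v hv)
          (by rw [hP.partner_partner v hv]; exact hpv.symm) j i hj hi hjv
          (by rw [hP.partner_partner v hv]; exact hiv) hij hej
        rw [hP.partner_partner v hv] at this
        exact Or.inl this

end Hypergraph

/-! ### Addresses of nodes and paths to leaves -/

namespace BinTree

/-- One of the two subtrees below the root. -/
def child (b : Bool) : BinTree → Option BinTree
  | leaf => none
  | node l r => some (cond b l r)

/-- The subtree below the node with a given address. The address of a node lists the
directions taken from the root to the node, with the last direction first. -/
def subtreeAt (T : BinTree) : List Bool → Option BinTree
  | [] => some T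
  | b :: v => (T.subtreeAt v).bind (child b)

theorem subtreeAt_append (T : BinTree) (u v : List Bool) :
    T.subtreeAt (u ++ v) = (T.subtreeAt v).bind fun S => S.subtreeAt u := by
  induction u with
  | nil => simp [subtreeAt]
  | cons b u ih =>
    rw [List.cons_append, subtreeAt, ih, Option.bind_assoc]
    rfl

theorem isSome_subtreeAt_of_suffix {T : BinTree} {u v : List Bool} (h : v <:+ u)
    (hu : (T.subtreeAt u).isSome) : (T.subtreeAt v).isSome := by
  obtain ⟨w, rfl⟩ := h
  rw [subtreeAt_append] at hu
  cases hv : T.subtreeAt v with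
  | none => simp [hv] at hu
  | some S => rfl

theorem isSome_subtreeAt_cons {T : BinTree} {b c : Bool} {v : List Bool}
    (h : (T.subtreeAt (b :: v)).isSome) : (T.subtreeAt (c :: v)).isSome := by
  simp only [subtreeAt] at h ⊢
  cases hv : T.subtreeAt v with
  | none => simp [hv] at h
  | some S => cases S <;> simp [hv, child] at h ⊢

/-- The addresses of the leaves at distance `i` from the root. -/
def leafSet (T : BinTree) (i : ℕ) : Set (List Bool) :=
  {u | T.subtreeAt u = some leaf ∧ u.length = i}

theorem subtreeAt_append_singleton (l r : BinTree) (u : List Bool) (b : Bool) :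
    (node l r).subtreeAt (u ++ [b]) = (cond b l r).subtreeAt u := by
  simp [subtreeAt_append, subtreeAt, child]

theorem finite_nodes (T : BinTree) : {v | (T.subtreeAt v).isSome}.Finite := by
  induction T with
  | leaf =>
    refine (Set.finite_singleton []).subset fun v hv => ?_
    rcases v.eq_nil_or_concat with rfl | ⟨u, b, rfl⟩
    · rfl
    · simp [subtreeAt_append, subtreeAt, child] at hv
  | node l r ihl ihr =>
    refine ((Set.finite_singleton []).union
      ((ihl.image (· ++ [true])).union (ihr.image (· ++ [false])))).subset fun v hv => ?_
    rcases v.eq_nil_or_concat with rfl | ⟨u, b, rfl⟩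
    · exact Or.inl rfl
    · rw [List.concat_eq_append] at hv ⊢
      rw [Set.mem_ofPred_eq, subtreeAt_append_singleton] at hv
      cases b
      · exact Or.inr (Or.inr ⟨u, hv, rfl⟩)
      · exact Or.inr (Or.inl ⟨u, hv, rfl⟩)

theorem finite_leafSet (T : BinTree) (i : ℕ) : (T.leafSet i).Finite :=
  T.finite_nodes.subset fun u hu => by simp [hu.1]

theorem ncard_leafSet_le (T : BinTree) (i : ℕ) : (T.leafSet i).ncard ≤ T.leavesAt i := by
  induction T generalizing i with
  | leaf =>
    cases i with
    | zero =>
      refine (Set.ncard_le_ncard (t := {[]}) fun u hu => ?_).trans (Set.ncard_singleton _).le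
      exact List.length_eq_zero_iff.1 hu.2
    | succ i =>
      rw [Set.eq_empty_of_forall_notMem (s := leaf.leafSet (i + 1)) fun u hu => ?_]
      · simp
      rcases u.eq_nil_or_concat with rfl | ⟨u, b, rfl⟩
      · exact absurd hu.2 (by simp)
      · simpa [subtreeAt_append, subtreeAt, child] using hu.1
  | node l r ihl ihr =>
    cases i with
    | zero =>
      rw [Set.eq_empty_of_forall_notMem (s := (node l r).leafSet 0) fun u hu => ?_]
      · simp
      have h1 := List.length_eq_zero_iff.1 hu.2
      have h2 := hu.1
      subst h1
      simp [subtreeAt] at h2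
    | succ i =>
      have hsub : (node l r).leafSet (i + 1) ⊆
          (· ++ [true]) '' l.leafSet i ∪ (· ++ [false]) '' r.leafSet i := by
        rintro u ⟨hu, hlen⟩
        rcases u.eq_nil_or_concat with rfl | ⟨u, b, rfl⟩
        · simp at hlen
        · rw [List.concat_eq_append] at hu hlen ⊢
          rw [subtreeAt_append_singleton] at hu
          replace hlen : u.length = i := by simpa using hlen
          cases b
          · exact Or.inr ⟨u, ⟨hu, hlen⟩, rfl⟩
          · exact Or.inl ⟨u, ⟨hu, hlen⟩, rfl⟩
      refine (Set.ncard_le_ncard hsub (((l.finite_leafSet i).image _).union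
        ((r.finite_leafSet i).image _))).trans ((Set.ncard_union_le _ _).trans ?_)
      exact Nat.add_le_add
        ((Set.ncard_image_le (l.finite_leafSet i)).trans (ihl i))
        ((Set.ncard_image_le (r.finite_leafSet i)).trans (ihr i))

theorem ncard_leaves_lt_le (T : BinTree) (n : ℕ) :
    {u | T.subtreeAt u = some leaf ∧ u.length < n}.ncard ≤
      ∑ i ∈ Finset.range n, T.leavesAt i := by
  induction n with
  | zero => simp
  | succ n ih =>
    have : {u | T.subtreeAt u = some leaf ∧ u.length < n + 1} =
        {u | T.subtreeAt u = some leaf ∧ u.length < n} ∪ T.leafSet n := by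
      ext u
      simp only [leafSet, Set.mem_union, Set.mem_ofPred_eq, ← and_or_left, Nat.lt_succ_iff_lt_or_eq]
    rw [this, Finset.sum_range_succ]
    exact (Set.ncard_union_le _ _).trans (Nat.add_le_add ih (T.ncard_leafSet_le n))

theorem IsSparse.subtreeAt {n d : ℕ} {T : BinTree} (h : T.IsSparse n d) {v : List Bool}
    {S : BinTree} (hS : T.subtreeAt v = some S) : S.IsSparse n d := by
  induction v generalizing S with
  | nil =>
    obtain rfl : T = S := by simpa [BinTree.subtreeAt] using hS
    exact h
  | cons b v ih =>
    simp only [BinTree.subtreeAt, Option.bind_eq_some_iff] at hS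
    obtain ⟨U, hU, hb⟩ := hS
    have := ih hU
    cases U with
    | leaf => simp [child] at hb
    | node l r =>
      obtain rfl : cond b l r = S := by simpa [child] using hb
      cases b
      · exact this.2.2
      · exact this.2.1

/-- The lowest `n` nodes on the path from the root to the node `u`. -/
def lowerPath (n : ℕ) (u : List Bool) : Set (List Bool) :=
  {v | v <:+ u ∧ u.length < v.length + n}

theorem encard_lowerPath {n : ℕ} {u : List Bool} (h : n ≤ u.length + 1) :
    (lowerPath n u).encard = n := by
  have : lowerPath n u = (fun i => u.drop i) '' (Finset.range n : Set ℕ) := by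
    ext v
    constructor
    · rintro ⟨⟨w, rfl⟩, hlen⟩
      exact ⟨w.length, by simp at hlen ⊢; omega, by simp⟩
    · rintro ⟨i, hi, rfl⟩
      have := Finset.mem_range.1 hi
      exact ⟨List.drop_suffix _ _, by simp; omega⟩
  rw [this, Set.InjOn.encard_image, Set.encard_coe_eq_coe_finsetCard, Finset.card_range]
  intro i hi i' hi' heq
  have h1 := Finset.mem_range.1 hi
  have h2 := Finset.mem_range.1 hi'
  have := congrArg List.length heq
  simp only [List.length_drop] at this
  omega

/-- Among the lower paths to the leaves, those through `v` correspond to the leaves at distance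
less than `n` from `v`. -/
theorem setOf_leaf_mem_lowerPath_subset {T S : BinTree} {n : ℕ} {v : List Bool}
    (hS : T.subtreeAt v = some S) :
    {u | T.subtreeAt u = some leaf ∧ v ∈ lowerPath n u} ⊆
      (· ++ v) '' {u | S.subtreeAt u = some leaf ∧ u.length < n} := by
  rintro _ ⟨hu, ⟨w, rfl⟩, hlen⟩
  rw [subtreeAt_append, hS] at hu
  refine ⟨w, ⟨hu, ?_⟩, rfl⟩
  rw [List.length_append] at hlen
  omega

/-- A set containing the root and one node of each pair of siblings contains a path from the
root to a leaf. -/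
theorem exists_leaf_path (T : BinTree) (M : Set (List Bool)) (h0 : [] ∈ M)
    (h : ∀ v, (T.subtreeAt (true :: v)).isSome → true :: v ∈ M ∨ false :: v ∈ M) :
    ∃ u, T.subtreeAt u = some leaf ∧ ∀ v, v <:+ u → v ∈ M := by
  suffices H : ∀ S : BinTree, ∀ v, T.subtreeAt v = some S → (∀ w, w <:+ v → w ∈ M) →
      ∃ u, T.subtreeAt u = some leaf ∧ ∀ v, v <:+ u → v ∈ M from
    H T [] rfl fun w hw => by rwa [List.suffix_nil.1 hw]
  intro S
  induction S with
  | leaf => exact fun v hv hM => ⟨v, hv, hM⟩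
  | node l r ihl ihr =>
    intro v hv hM
    have hc : ∀ b, T.subtreeAt (b :: v) = some (cond b l r) := fun b => by
      simp [subtreeAt, hv, child]
    rcases h v (by simp [hc]) with hb | hb
    · refine ihl _ (hc true) fun w hw => ?_
      rcases List.suffix_cons_iff.1 hw with rfl | hw
      exacts [hb, hM w hw]
    · refine ihr _ (hc false) fun w hw => ?_
      rcases List.suffix_cons_iff.1 hw with rfl | hw
      exacts [hb, hM w hw]

end BinTree

/-! ### The hypergraph of a sparse tree -/

namespace Hypergraph

open BinTree

/-- The hyperedge number `j` of the star `b`: the center `(b, none)` and `n - 1` further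
vertices. -/
def spoke (n d : ℕ) (b : Bool) (j : Fin d) : Set (Bool × Option (Fin d × Fin (n - 1))) :=
  Set.range fun o : Option (Fin (n - 1)) => (b, o.map (Prod.mk j))

/-- The hypergraph of the lower paths to the leaves of `T`, together with two disjoint stars
consisting of `d` hyperedges each, which make sure that the degree `d` is attained. -/
def treeHypergraph (n d : ℕ) (T : BinTree) :
    Hypergraph (List Bool ⊕ (Bool × Option (Fin d × Fin (n - 1)))) where
  vertexSet := Sum.inl '' {v | (T.subtreeAt v).isSome} ∪ Set.range Sum.inr
  edgeSet := {e | ∃ u, T.subtreeAt u = some leaf ∧ e = Sum.inl '' lowerPath n u} ∪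
    {e | ∃ b j, e = Sum.inr '' spoke n d b j}
  subset_vertexSet_of_mem_edgeSet' := by
    rintro e (⟨u, hu, rfl⟩ | ⟨b, j, rfl⟩)
    · rintro _ ⟨v, hv, rfl⟩
      exact Or.inl ⟨v, isSome_subtreeAt_of_suffix hv.1 (by simp [hu]), rfl⟩
    · rintro _ ⟨v, -, rfl⟩
      exact Or.inr ⟨v, rfl⟩

variable {n d : ℕ} {T : BinTree}

theorem finite_vertexSet_treeHypergraph : (treeHypergraph n d T).vertexSet.Finite :=
  (T.finite_nodes.image _).union (Set.finite_range _)

theorem encard_spoke (hn : 0 < n) (b : Bool) (j : Fin d) : (spoke n d b j).encard = n := by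
  have hinj : Function.Injective fun o : Option (Fin (n - 1)) => (b, o.map (Prod.mk j)) :=
    fun o o' h => Option.map_injective (Prod.mk_right_injective j) (Prod.mk.inj h).2
  rw [spoke, ← Set.image_univ, hinj.encard_image, Set.encard_univ, ENat.card_eq_coe_fintype_card,
    Fintype.card_option, Fintype.card_fin, Nat.sub_add_cancel hn]

theorem isUniform_treeHypergraph (hn : 0 < n)
    (hT : ∀ u, T.subtreeAt u = some leaf → n ≤ u.length + 1) :
    (treeHypergraph n d T).IsUniform n := by
  rintro e (⟨u, hu, rfl⟩ | ⟨b, j, rfl⟩)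
  · rw [Sum.inl_injective.encard_image, encard_lowerPath (hT u hu)]
  · rw [Sum.inr_injective.encard_image, encard_spoke hn]

theorem degree_inl_le (hT : T.IsSparse n d) (v : List Bool) (hv : (T.subtreeAt v).isSome) :
    (treeHypergraph n d T).degree (Sum.inl v) ≤ d := by
  obtain ⟨S, hS⟩ := Option.isSome_iff_exists.1 hv
  have hfin : {u | S.subtreeAt u = some leaf ∧ u.length < n}.Finite :=
    S.finite_nodes.subset fun u hu => by simp [hu.1]
  have hsub : {e | e ∈ (treeHypergraph n d T).edgeSet ∧ Sum.inl v ∈ e} ⊆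
      (fun u => Sum.inl '' lowerPath n u) ''
        {u | T.subtreeAt u = some leaf ∧ v ∈ lowerPath n u} := by
    rintro e ⟨⟨u, hu, rfl⟩ | ⟨b, j, rfl⟩, he⟩
    · exact ⟨u, ⟨hu, by simpa using he⟩, rfl⟩
    · simp at he
  have hpath := setOf_leaf_mem_lowerPath_subset (n := n) hS
  have hfin' := (hfin.image (· ++ v)).subset hpath
  calc _ ≤ _ := Set.ncard_le_ncard hsub (hfin'.image _)
    _ ≤ _ := Set.ncard_image_le hfin'
    _ ≤ _ := Set.ncard_le_ncard hpath (hfin.image _)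
    _ ≤ _ := Set.ncard_image_le hfin
    _ ≤ _ := S.ncard_leaves_lt_le n
    _ ≤ d := (hT.subtreeAt hS).sum_le

theorem degree_inr_le (b : Bool) (o : Option (Fin d × Fin (n - 1))) :
    (treeHypergraph n d T).degree (Sum.inr (b, o)) ≤ d := by
  have hsub : {e | e ∈ (treeHypergraph n d T).edgeSet ∧ Sum.inr (b, o) ∈ e} ⊆
      Set.range fun j => Sum.inr '' spoke n d b j := by
    rintro e ⟨⟨u, hu, rfl⟩ | ⟨b', j, rfl⟩, he⟩
    · simp at he
    · obtain ⟨_, ⟨o', rfl⟩, h⟩ := he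
      obtain rfl : b' = b := (Prod.mk.inj (Sum.inr_injective h)).1
      exact ⟨j, rfl⟩
  calc _ ≤ _ := Set.ncard_le_ncard hsub (Set.finite_range _)
    _ ≤ (Set.univ : Set (Fin d)).ncard := by
      rw [← Set.image_univ]
      exact Set.ncard_image_le Set.finite_univ
    _ = d := by simp

/-- Since `n ≥ 2`, each spoke has a vertex besides the center, so the `d` spokes are distinct. -/
theorem degree_center (hn : 2 ≤ n) (b : Bool) :
    (treeHypergraph n d T).degree (Sum.inr (b, none)) = d := by
  refine le_antisymm (degree_inr_le b none) ?_
  have hinj : Function.Injective fun j => (Sum.inr '' spoke n d b j :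
      Set (List Bool ⊕ (Bool × Option (Fin d × Fin (n - 1))))) := by
    intro j j' h
    have h' := Sum.inr_injective.image_injective h
    have hmem : (b, some (j, ⟨0, by omega⟩)) ∈ spoke n d b j' := by
      rw [← h']
      exact ⟨some ⟨0, by omega⟩, rfl⟩
    obtain ⟨_ | o, ho⟩ := hmem
    · simp at ho
    · simp only [Option.map_some, Prod.mk.injEq, Option.some.injEq, true_and] at ho
      exact ho.1.symm
  have hcard : (Set.range fun j => (Sum.inr '' spoke n d b j :
      Set (List Bool ⊕ (Bool × Option (Fin d × Fin (n - 1)))))).ncard = d := by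
    rw [← Set.image_univ, Set.ncard_image_of_injective _ hinj, Set.ncard_univ, Nat.card_fin]
  conv_lhs => rw [← hcard]
  refine Set.ncard_le_ncard ?_ ?_
  · rintro _ ⟨j, rfl⟩
    exact ⟨Or.inr ⟨b, j, rfl⟩, ⟨_, ⟨none, rfl⟩, rfl⟩⟩
  · exact finite_vertexSet_treeHypergraph.finite_subsets.subset fun e he =>
      (treeHypergraph n d T).subset_vertexSet_of_mem_edgeSet' he.1

theorem maxDegree_treeHypergraph (hn : 2 ≤ n) (hT : T.IsSparse n d) :
    (treeHypergraph n d T).maxDegree = d := by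
  have hle : ∀ x ∈ (treeHypergraph n d T).degree '' (treeHypergraph n d T).vertexSet, x ≤ d := by
    rintro _ ⟨_, ⟨v, hv, rfl⟩ | ⟨⟨b, o⟩, rfl⟩, rfl⟩
    · exact degree_inl_le hT v hv
    · exact degree_inr_le b o
  have hmem : d ∈ (treeHypergraph n d T).degree '' (treeHypergraph n d T).vertexSet :=
    ⟨Sum.inr (true, none), Or.inr ⟨_, rfl⟩, degree_center hn true⟩
  exact IsGreatest.csSup_eq ⟨hmem, hle⟩

/-- Siblings in the tree are paired, and so are corresponding vertices of the two stars. -/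
def siblingOrTwin {β : Type*} : List Bool ⊕ (Bool × β) → List Bool ⊕ (Bool × β)
  | Sum.inl [] => Sum.inl []
  | Sum.inl (b :: v) => Sum.inl ((!b) :: v)
  | Sum.inr (b, o) => Sum.inr (!b, o)

theorem isPairing_treeHypergraph :
    (treeHypergraph n d T).IsPairing (Sum.inl []) siblingOrTwin where
  first_mem := Or.inl ⟨[], rfl, rfl⟩
  partner_mem := by
    rintro _ (⟨_ | ⟨b, v⟩, hv, rfl⟩ | ⟨⟨b, o⟩, rfl⟩)
    · exact Or.inl ⟨[], rfl, rfl⟩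
    · exact Or.inl ⟨_, isSome_subtreeAt_cons hv, rfl⟩
    · exact Or.inr ⟨_, rfl⟩
  partner_partner := by
    rintro ((_ | ⟨b, v⟩) | ⟨b, o⟩) - <;> simp [siblingOrTwin]
  partner_first := rfl
  unpaired := by
    rintro ((_ | ⟨b, v⟩) | ⟨b, o⟩) ⟨-, h1, h2⟩ <;> simp [siblingOrTwin] at h1 h2

theorem hasWinningPairingStrategy_treeHypergraph :
    (treeHypergraph n d T).HasWinningPairingStrategy := by
  refine hasWinningPairingStrategy_of_isPairing isPairing_treeHypergraph fun M h0 hM => ?_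
  obtain ⟨u, hu, hpath⟩ := T.exists_leaf_path (Sum.inl ⁻¹' M) h0 fun v hv =>
    hM (Sum.inl (true :: v)) (Or.inl ⟨_, hv, rfl⟩) (by simp [siblingOrTwin])
  refine ⟨_, Or.inl ⟨u, hu, rfl⟩, ?_⟩
  rintro _ ⟨v, hv, rfl⟩
  exact hpath v hv.1

end Hypergraph

/-! ### Conclusion -/

theorem BinTree.le_length_of_leavesAt_eq_zero {T : BinTree} {n : ℕ}
    (h : ∀ i < n, T.leavesAt i = 0) {u : List Bool} (hu : T.subtreeAt u = some leaf) :
    n ≤ u.length := by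
  by_contra! hlt
  have h1 := (T.ncard_leafSet_le u.length).trans (h _ hlt).le
  have h2 := (Set.ncard_eq_zero (T.finite_leafSet _)).1 (Nat.le_zero.1 h1)
  exact Set.eq_empty_iff_forall_notMem.1 h2 u ⟨hu, rfl⟩

theorem theorem1p3 :
    ∃ N : ℕ, ∀ n : ℕ, N ≤ n → (∃ k : ℕ, (64 / 63 : ℚ) * (n : ℚ) = 2 ^ k) →
      ∃ (α : Type) (H : Hypergraph α), H.vertexSet.Finite ∧ H.IsUniform n ∧
        (H.maxDegree : ℚ) = 2 ^ (n - 1) / ((64 / 63 : ℚ) * (n : ℚ)) ∧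
        H.HasWinningPairingStrategy := by
  -- `c * n = 2 ^ k` means `n = 63 * 2 ^ (k - 6)`; the bound on `n` gives `j = k - 6 ≥ 10`, as the
  -- chunk estimates require.
  refine ⟨63 * 2 ^ 10, fun n hN ⟨k, hk⟩ => ?_⟩
  have hk' : 64 * n = 63 * 2 ^ k := by
    have : (64 * n : ℚ) = 63 * 2 ^ k := by linarith
    exact_mod_cast this
  have hk16 : 16 ≤ k := by
    refine (Nat.pow_le_pow_iff_right (a := 2) (by norm_num)).1 ?_
    norm_num at hN ⊢
    omega
  obtain ⟨j, rfl⟩ := Nat.exists_eq_add_of_le' (show 6 ≤ k by omega)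
  have hn : n = 63 * 2 ^ j := by
    rw [pow_add] at hk'
    omega
  have hj : 10 ≤ j := by omega
  have hjm := BinTree.add_fifteen_le_two_pow hj
  obtain ⟨T, hT, hT0⟩ := BinTree.exists_isSparse hj hn rfl
  refine ⟨_, Hypergraph.treeHypergraph n (2 ^ (n - 1 - (j + 6))) T,
    Hypergraph.finite_vertexSet_treeHypergraph,
    Hypergraph.isUniform_treeHypergraph (by omega) fun u hu => ?_, ?_,
    Hypergraph.hasWinningPairingStrategy_treeHypergraph⟩
  · have := BinTree.le_length_of_leavesAt_eq_zero hT0 hu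
    omega
  · rw [Hypergraph.maxDegree_treeHypergraph (by omega) hT, hk, eq_div_iff (by positivity)]
    push_cast
    rw [← pow_add]
    congr 1
    omega
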